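/- **Setting.** $L^2(\mathbb R)$ denotes the space of $2\times 2$ matrix valued functions with entries in $L^2(\mathbb R;\mathbb C)$, normed by $\|f\|_2=\big\|(\operatorname{tr} f^*f)^{1/2}\big\|_{L^2}$. Let $H_\pm$ be the orthogonal projections of scalar $L^2(\mathbb R;\mathbb C)$ onto the Hardy spaces $H_2(\mathbb C_\pm)$ of the upper and lower half planes, and let $C_+=H_+$, $C_-=-H_-$, acting entrywise on matrices. For a pair $w=(w^-,w^+)$ of $2\times2$ matrix valued $L^\infty(\mathbb R)$ functions, let $C_w f=C_+(fw^-)+C_-(fw^+)$. Let $p,q\in\mathbb C$ be constants with $pq$ real and $1+pq>0$, and let $k\ge 1$ be an integer, $a,b,\omega,t\in\mathbb R$, $b\ne0$. Put $\Theta(x)=a+bx^{k+1}$, $D_\pm=\{x\in\mathbb R:\pm\Theta'(x)>0\}$, $\nu=-\frac1{2\pi}\ln(1+pq)$, and $\epsilon=0$ for $k$ even, $\epsilon=\operatorname{sgn} b$ for $k$ odd. For $z\in\mathbb C\setminus\mathbb R$ let $\delta(z)=e^{i\omega+\beta(z)}$, where $$\beta(z)=\begin{cases}0,&0\text{ is an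 exterior point of }\overline{D_-},\\ i\epsilon\nu\ln(\epsilon z),&0\text{ is an endpoint of }\overline{D_-},\\ -\pi\nu\,\operatorname{sgn}(\operatorname{Im}z),&0\text{ is an interior point of }\overline{D_-}\end{cases}$$ (principal logarithm), and let $\delta_\pm$ be the boundary values of $\delta$ on $\mathbb R$ from the upper and lower half planes. The model weights $w_M=(w_M^-,w_M^+)$ are $$(w_M^-,w_M^+)=\begin{cases}\left(\begin{pmatrix}0&\delta_-^2\,p\,e^{-it\Theta}\\0&0\end{pmatrix},\begin{pmatrix}0&0\\ \delta_+^{-2}\,q\,e^{it\Theta}&0\end{pmatrix}\right),&x\in D_+,\\[2ex]\left(\begin{pmatrix}0&0\\ \delta_-^{-2}\frac{q}{1+pq}e^{it\Theta}&0\end{pmatrix},\begin{pmatrix}0&\delta_+^{2}\frac{p}{1+pq}e^{-it\Theta}\\0&0\end{pmatrix}\right),&x\in D_-.\end{cases}$$ **Proposition (resolvent bound).** Let $p,q\in\mathbb C$ with $pq$ real and $-1<pq<1$. There is a constant $C$, depending only on $p$ and $q$, such that for all integers $k\ge1$ and all real $a,b,\omega,t$ with $b\neq0$, the operator $1-C_{w_M}$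 is invertible on $L^2(\mathbb R)$ and $$\|(1-C_{w_M})^{-1}\|_{L^2(\mathbb R)\to L^2(\mathbb R)}\le C.$$ -/

import Mathlib

open MeasureTheory Filter Topology
open scoped ENNReal

noncomputable section

namespace ModelRHP

/-! ### Hardy spaces and Cauchy operators on the real line -/

/-- The complex space `L²(ℝ)`. -/
abbrev L2 : Type := Lp ℂ 2 (volume : Measure ℝ)

/-- The complex space `L^∞(ℝ)`. -/
abbrev LInf : Type := Lp ℂ ∞ (volume : Measure ℝ)

/-- For `s = 1` (resp. `s = -1`): `f` is the boundary function of an element `F` of the Hardy space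
`H₂` of the upper (resp. lower) half plane, i.e. `F` is holomorphic in the half plane, its `L²` norms
on horizontal lines are uniformly bounded, and `F (· + i s y) → f` in `L²(ℝ)` as `y → 0+`. -/
def IsHardyBoundary (s : ℝ) (f : L2) : Prop :=
  ∃ F : ℂ → ℂ, DifferentiableOn ℂ F {z : ℂ | 0 < s * z.im} ∧
    (∃ M : ℝ≥0∞, M < ∞ ∧ ∀ y : ℝ, 0 < y →
      eLpNorm (fun x : ℝ => F ((x : ℂ) + ((s * y : ℝ) : ℂ) * Complex.I)) 2 volume ≤ M) ∧
    Tendsto (fun y : ℝ =>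
      eLpNorm (fun x : ℝ => F ((x : ℂ) + ((s * y : ℝ) : ℂ) * Complex.I) - f x) 2 volume)
      (𝓝[>] 0) (𝓝 0)

theorem continuous_line {s : ℝ} {F : ℂ → ℂ} (hF : DifferentiableOn ℂ F {z : ℂ | 0 < s * z.im})
    (hs : s * s = 1) {y : ℝ} (hy : 0 < y) :
    Continuous (fun x : ℝ => F ((x : ℂ) + ((s * y : ℝ) : ℂ) * Complex.I)) := by
  refine hF.continuousOn.comp_continuous (by fun_prop) fun x => ?_
  simp only [Set.mem_ofPred_eq, Complex.add_im, Complex.ofReal_im, Complex.im_ofReal_mul, Complex.I_im, mul_one, zero_add]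
  nlinarith

/-- The Hardy space `H₂` of the upper (`s = 1`) or lower (`s = -1`) half plane, identified with the
space of boundary functions in `L²(ℝ)`. -/
def hardySpace (s : ℝ) (hs : s * s = 1) : Submodule ℂ L2 where
  carrier := {f | IsHardyBoundary s f}
  zero_mem' := by
    refine ⟨fun _ => 0, by fun_prop, ⟨0, by simp, fun y _ => by simp⟩, ?_⟩
    refine tendsto_const_nhds.congr fun y => ?_
    rw [eq_comm, eLpNorm_congr_ae (g := 0) ?_, eLpNorm_zero]
    filter_upwards [Lp.coeFn_zero ℂ 2 (volume : Measure ℝ)] with x hx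
    simp
  add_mem' := by
    rintro f g ⟨F, hF, ⟨M, hM, hFM⟩, hFf⟩ ⟨G, hG, ⟨N, hN, hGN⟩, hGg⟩
    refine ⟨fun z => F z + G z, hF.add hG, ⟨M + N, ENNReal.add_lt_top.2 ⟨hM, hN⟩, fun y hy => ?_⟩, ?_⟩
    · exact (eLpNorm_add_le (continuous_line hF hs hy).aestronglyMeasurable
        (continuous_line hG hs hy).aestronglyMeasurable (by norm_num)).trans
        (add_le_add (hFM y hy) (hGN y hy))
    · have h0 := hFf.add hGg
      rw [add_zero] at h0
      refine tendsto_of_tendsto_of_tendsto_of_le_of_le' tendsto_const_nhds h0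
        (Eventually.of_forall fun _ => zero_le) ?_
      filter_upwards [self_mem_nhdsWithin] with y hy
      refine le_trans (le_of_eq (eLpNorm_congr_ae ?_)) (eLpNorm_add_le
        ((continuous_line hF hs hy).aestronglyMeasurable.sub (Lp.aestronglyMeasurable f))
        ((continuous_line hG hs hy).aestronglyMeasurable.sub (Lp.aestronglyMeasurable g))
        (by norm_num))
      filter_upwards [Lp.coeFn_add f g] with x hx
      simp only [hx, Pi.add_apply]
      ring
  smul_mem' := by
    rintro c f ⟨F, hF, ⟨M, hM, hFM⟩, hFf⟩
    refine ⟨fun z => c * F z, hF.const_mul c, ⟨‖c‖ₑ * M, ENNReal.mul_lt_top (by simp) hM,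
      fun y hy => ?_⟩, ?_⟩
    · refine le_trans (le_of_eq ?_) (mul_le_mul_right (hFM y hy) ‖c‖ₑ)
      exact eLpNorm_const_smul c _ _ _
    · have h0 := ENNReal.Tendsto.const_mul (a := ‖c‖ₑ) hFf (Or.inr (by simp))
      rw [mul_zero] at h0
      refine h0.congr fun y => ?_
      rw [← eLpNorm_const_smul c]
      refine eLpNorm_congr_ae ?_
      filter_upwards [Lp.coeFn_smul c f] with x hx
      simp only [hx, Pi.smul_apply, smul_eq_mul]
      ring

/-- The orthogonal projection of `L²(ℝ)` onto the Hardy space of the upper (`s = 1`) or lower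
(`s = -1`) half plane. The Hardy space is a closed subspace, so passing to the closure does not
change it; the closure is written only because its completeness is available by definition. -/
def hardyProj (s : ℝ) (hs : s * s = 1) : L2 →L[ℂ] L2 :=
  (hardySpace s hs).topologicalClosure.starProjection

/-- `C₊ = H₊`, the projection onto the Hardy space of the upper half plane. -/
def cauchyPlus : L2 →L[ℂ] L2 := hardyProj 1 (by norm_num)

/-- `C₋ = -H₋`, where `H₋` is the projection onto the Hardy space of the lower half plane. -/
def cauchyMinus : L2 →L[ℂ] L2 := -hardyProj (-1) (by norm_num)

/-! ### The Beals–Coifman operator -/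

/-- Multiplication of `L²` functions by an `L^∞` function. -/
def mulOp (g : LInf) : L2 →L[ℂ] L2 :=
  (ContinuousLinearMap.mul ℂ ℂ).holderL volume ∞ 2 2 g

/-- `2 × 2` matrices of `L²(ℝ)` functions, with the norm `(∑ᵢⱼ ‖fᵢⱼ‖₂²)^(1/2) = ‖ |f| ‖₂`, where
`|f| = (tr f* f)^(1/2)` pointwise. -/
abbrev L2Mat : Type := PiLp 2 (fun _ : Fin 2 × Fin 2 => L2)

/-- The Beals–Coifman operator `C_w f = C₊ (f w⁻) + C₋ (f w⁺)` on matrix valued `L²` functions, for a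
pair `(w⁻, w⁺)` of matrix valued `L^∞` weights: `f w^∓` is a matrix product and `C_±` act entrywise. -/
def bealsCoifman (wMinus wPlus : Matrix (Fin 2) (Fin 2) LInf) : L2Mat →L[ℂ] L2Mat :=
  (PiLp.continuousLinearEquiv 2 ℂ (fun _ : Fin 2 × Fin 2 => L2)).symm.toContinuousLinearMap ∘L
    ContinuousLinearMap.pi fun ij : Fin 2 × Fin 2 =>
      cauchyPlus ∘L (∑ l : Fin 2,
        mulOp (wMinus l ij.2) ∘L PiLp.proj 2 (fun _ : Fin 2 × Fin 2 => L2) (ij.1, l)) +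
      cauchyMinus ∘L (∑ l : Fin 2,
        mulOp (wPlus l ij.2) ∘L PiLp.proj 2 (fun _ : Fin 2 × Fin 2 => L2) (ij.1, l))

theorem bealsCoifman_apply (wMinus wPlus : Matrix (Fin 2) (Fin 2) LInf) (f : L2Mat)
    (i j : Fin 2) :
    bealsCoifman wMinus wPlus f (i, j) =
      cauchyPlus (∑ l : Fin 2, mulOp (wMinus l j) (f (i, l))) +
      cauchyMinus (∑ l : Fin 2, mulOp (wPlus l j) (f (i, l))) := by
  simp [bealsCoifman]

/-! ### The model weights -/

/-- The model phase `Θ(x) = a + b x^(k+1)`. -/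
def phase (k : ℕ) (a b x : ℝ) : ℝ := a + b * x ^ (k + 1)

/-- `D₊ = {Θ' > 0}`. -/
def DPlus (k : ℕ) (a b : ℝ) : Set ℝ := {x | 0 < deriv (phase k a b) x}

/-- `D₋ = {Θ' < 0}`. -/
def DMinus (k : ℕ) (a b : ℝ) : Set ℝ := {x | deriv (phase k a b) x < 0}

/-- `ε = 0` for even `k` and `ε = sgn b` for odd `k`. -/
def eps (k : ℕ) (b : ℝ) : ℝ := if Even k then 0 else Real.sign b

/-- `ν = -(1 / 2π) ln (1 + pq)`; it is used for real `pq > -1` only. -/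
def nu (p q : ℂ) : ℝ := -(1 / (2 * Real.pi)) * Real.log (1 + (p * q).re)

open Classical in
/-- `β(z)`: it equals `i ε ν ln (ε z)` if `0` is an endpoint of the closure of `D₋`,
`-π ν sgn (Im z)` if `0` is an interior point of it, and `0` if `0` is an exterior point of it. -/
def beta (k : ℕ) (a b : ℝ) (p q z : ℂ) : ℂ :=
  if (0 : ℝ) ∈ frontier (closure (DMinus k a b)) then
    Complex.I * (eps k b : ℂ) * (nu p q : ℂ) * Complex.log ((eps k b : ℂ) * z)
  else if (0 : ℝ) ∈ interior (closure (DMinus k a b)) then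
    -((Real.pi * nu p q * Real.sign z.im : ℝ) : ℂ)
  else 0

/-- `δ(z) = exp (i ω + β(z))`, for `z` off the real line. -/
def delta (k : ℕ) (a b ω : ℝ) (p q z : ℂ) : ℂ :=
  Complex.exp (Complex.I * (ω : ℂ) + beta k a b p q z)

/-- Boundary value at `x ∈ ℝ` from the upper (`s = 1`) or lower (`s = -1`) half plane. -/
def boundaryValue (s : ℝ) (F : ℂ → ℂ) (x : ℝ) : ℂ :=
  limUnder (𝓝[>] (0 : ℝ)) fun y : ℝ => F ((x : ℂ) + ((s * y : ℝ) : ℂ) * Complex.I)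

/-- The boundary value `δ₊` of `δ` from the upper half plane. -/
def deltaPlus (k : ℕ) (a b ω : ℝ) (p q : ℂ) (x : ℝ) : ℂ :=
  boundaryValue 1 (delta k a b ω p q) x

/-- The boundary value `δ₋` of `δ` from the lower half plane. -/
def deltaMinus (k : ℕ) (a b ω : ℝ) (p q : ℂ) (x : ℝ) : ℂ :=
  boundaryValue (-1) (delta k a b ω p q) x

/-- The oscillating factor `e^{i t Θ(x)}`. -/
def osc (k : ℕ) (a b t x : ℝ) : ℂ := Complex.exp (Complex.I * ((t * phase k a b x : ℝ) : ℂ))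

open Classical in
/-- The model weight `w⁻_M` as a matrix valued function. It is set to zero on the null set outside
`D₊ ∪ D₋`. -/
def weightMinusFun (k : ℕ) (a b ω t : ℝ) (p q : ℂ) (x : ℝ) : Matrix (Fin 2) (Fin 2) ℂ :=
  if x ∈ DPlus k a b then
    !![0, deltaMinus k a b ω p q x ^ 2 * p * (osc k a b t x)⁻¹; 0, 0]
  else if x ∈ DMinus k a b then
    !![0, 0; (deltaMinus k a b ω p q x ^ 2)⁻¹ * (q / (1 + p * q)) * osc k a b t x, 0]
  else 0

open Classical in
/-- The model weight `w⁺_M` as a matrix valued function. It is set to zero on the null set outside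
`D₊ ∪ D₋`. -/
def weightPlusFun (k : ℕ) (a b ω t : ℝ) (p q : ℂ) (x : ℝ) : Matrix (Fin 2) (Fin 2) ℂ :=
  if x ∈ DPlus k a b then
    !![0, 0; (deltaPlus k a b ω p q x ^ 2)⁻¹ * q * osc k a b t x, 0]
  else if x ∈ DMinus k a b then
    !![0, deltaPlus k a b ω p q x ^ 2 * (p / (1 + p * q)) * (osc k a b t x)⁻¹; 0, 0]
  else 0

/-! The remaining lemmas check that the boundary values of `δ` exist away from `0` and that the model
weights belong to `L^∞(ℝ)`. -/

theorem exists_tendsto_log (s c x : ℝ) (hx : x ≠ 0) :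
    ∃ L : ℂ, Tendsto (fun y : ℝ =>
      Complex.log ((c : ℂ) * ((x : ℂ) + ((s * y : ℝ) : ℂ) * Complex.I))) (𝓝[>] (0 : ℝ)) (𝓝 L) := by
  have hlim : Tendsto (fun y : ℝ => (c : ℂ) * ((x : ℂ) + ((s * y : ℝ) : ℂ) * Complex.I))
      (𝓝[>] (0 : ℝ)) (𝓝 ((c * x : ℝ) : ℂ)) := by
    have hc : Continuous (fun y : ℝ => (c : ℂ) * ((x : ℂ) + ((s * y : ℝ) : ℂ) * Complex.I)) := by
      fun_prop
    have := hc.tendsto 0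
    simp only [mul_zero, Complex.ofReal_zero, zero_mul, add_zero, ← Complex.ofReal_mul] at this
    exact this.mono_left nhdsWithin_le_nhds
  rcases eq_or_ne c 0 with rfl | hc
  · exact ⟨Complex.log 0, by simp⟩
  rcases lt_or_gt_of_ne (mul_ne_zero hc hx) with h | h
  · by_cases hcs : 0 ≤ c * s
    · exact ⟨_, (Complex.tendsto_log_nhdsWithin_im_nonneg_of_re_neg_of_im_zero
        (by simpa using h) (by simp)).comp (tendsto_nhdsWithin_iff.2 ⟨hlim, by
          filter_upwards [self_mem_nhdsWithin] with y hy
          have hy : 0 < y := hy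
          simp
          nlinarith [mul_nonneg hcs hy.le]⟩)⟩
    · exact ⟨_, (Complex.tendsto_log_nhdsWithin_im_neg_of_re_neg_of_im_zero
        (by simpa using h) (by simp)).comp (tendsto_nhdsWithin_iff.2 ⟨hlim, by
          filter_upwards [self_mem_nhdsWithin] with y hy
          have hy : 0 < y := hy
          simp
          nlinarith [mul_pos (neg_pos.2 (not_le.1 hcs)) hy]⟩)⟩
  · exact ⟨_, (continuousAt_clog (Complex.mem_slitPlane_iff.2
      (Or.inl (by simpa using h)))).tendsto.comp hlim⟩

theorem abs_eps_le (k : ℕ) (b : ℝ) : |eps k b| ≤ 1 := by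
  unfold eps
  split_ifs
  · simp
  · rcases Real.sign_apply_eq b with h | h | h <;> simp [h]

theorem abs_re_beta_le (k : ℕ) (a b : ℝ) (p q z : ℂ) :
    |(beta k a b p q z).re| ≤ Real.pi * |nu p q| := by
  have h0 : 0 ≤ Real.pi * |nu p q| := by positivity
  unfold beta
  split_ifs
  · have h1 : (Complex.I * (eps k b : ℂ) * (nu p q : ℂ) * Complex.log ((eps k b : ℂ) * z)).re
        = -(eps k b * nu p q * ((eps k b : ℂ) * z).arg) := by
      simp [Complex.log_im, mul_assoc]
    rw [h1, abs_neg, abs_mul, abs_mul]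
    have h2 := Complex.abs_arg_le_pi ((eps k b : ℂ) * z)
    have h3 := abs_eps_le k b
    have h4 : |eps k b| * |nu p q| ≤ |nu p q| := by nlinarith [abs_nonneg (nu p q)]
    calc _ ≤ |nu p q| * Real.pi := mul_le_mul h4 h2 (abs_nonneg _) (abs_nonneg _)
      _ = _ := mul_comm _ _
  · rw [Complex.neg_re, Complex.ofReal_re, abs_neg, abs_mul, abs_mul, abs_of_pos Real.pi_pos]
    have h3 : |Real.sign z.im| ≤ 1 := by
      rcases Real.sign_apply_eq z.im with h | h | h <;> simp [h]
    nlinarith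
  · simpa using h0

theorem exists_tendsto_beta (s : ℝ) (hs : s = 1 ∨ s = -1) (k : ℕ) (a b : ℝ) (p q : ℂ) (x : ℝ)
    (hx : x ≠ 0) :
    ∃ L : ℂ, Tendsto (fun y : ℝ => beta k a b p q ((x : ℂ) + ((s * y : ℝ) : ℂ) * Complex.I))
      (𝓝[>] (0 : ℝ)) (𝓝 L) := by
  unfold beta
  split_ifs
  · obtain ⟨L, hL⟩ := exists_tendsto_log s (eps k b) x hx
    exact ⟨_, hL.const_mul _⟩
  · refine ⟨-((Real.pi * nu p q * Real.sign s : ℝ) : ℂ), tendsto_const_nhds.congr' ?_⟩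
    filter_upwards [self_mem_nhdsWithin] with y hy
    have hy : 0 < y := hy
    have h1 : ((x : ℂ) + ((s * y : ℝ) : ℂ) * Complex.I).im = s * y := by
      simp only [Complex.add_im, Complex.ofReal_im, Complex.im_ofReal_mul, Complex.I_im, mul_one,
        zero_add]
    rw [h1]
    rcases hs with rfl | rfl
    · rw [one_mul, Real.sign_of_pos hy, Real.sign_of_pos one_pos]
    · rw [Real.sign_of_neg (by linarith : -1 * y < 0), Real.sign_of_neg (by norm_num)]
  · exact ⟨0, tendsto_const_nhds⟩

theorem boundaryValue_delta (s : ℝ) (hs : s = 1 ∨ s = -1) (k : ℕ) (a b ω : ℝ) (p q : ℂ) (x : ℝ)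
    (hx : x ≠ 0) :
    ∃ L : ℂ, |L.re| ≤ Real.pi * |nu p q| ∧
      Tendsto (fun y : ℝ => delta k a b ω p q ((x : ℂ) + ((s * y : ℝ) : ℂ) * Complex.I))
        (𝓝[>] (0 : ℝ)) (𝓝 (Complex.exp L)) ∧
      boundaryValue s (delta k a b ω p q) x = Complex.exp L := by
  obtain ⟨L, hL⟩ := exists_tendsto_beta s hs k a b p q x hx
  have h1 : Tendsto (fun y : ℝ => delta k a b ω p q ((x : ℂ) + ((s * y : ℝ) : ℂ) * Complex.I))
      (𝓝[>] (0 : ℝ)) (𝓝 (Complex.exp (Complex.I * (ω : ℂ) + L))) :=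
    (Complex.continuous_exp.tendsto _).comp (hL.const_add _)
  refine ⟨_, ?_, h1, h1.limUnder_eq⟩
  have h2 := le_of_tendsto ((Complex.continuous_re.abs.tendsto L).comp hL)
    (Eventually.of_forall fun y => abs_re_beta_le k a b p q _)
  simpa using h2

theorem measurable_delta (k : ℕ) (a b ω : ℝ) (p q : ℂ) : Measurable (delta k a b ω p q) := by
  have hsign : Measurable Real.sign :=
    Measurable.ite measurableSet_Iio measurable_const
      (Measurable.ite measurableSet_Ioi measurable_const measurable_const)
  have hbeta : Measurable (beta k a b p q) := by
    unfold beta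
    split_ifs
    · exact (Complex.measurable_log.comp (measurable_id.const_mul _)).const_mul _
    · exact (Complex.measurable_ofReal.comp
        ((hsign.comp Complex.measurable_im).const_mul _)).neg
    · exact measurable_const
  exact Complex.measurable_exp.comp (hbeta.const_add _)

theorem aestronglyMeasurable_boundaryValue (s : ℝ) (hs : s = 1 ∨ s = -1) (k : ℕ) (a b ω : ℝ)
    (p q : ℂ) :
    AEStronglyMeasurable (boundaryValue s (delta k a b ω p q)) (volume : Measure ℝ) := by
  refine aestronglyMeasurable_of_tendsto_ae (𝓝[>] (0 : ℝ))
    (f := fun (y x : ℝ) => delta k a b ω p q ((x : ℂ) + ((s * y : ℝ) : ℂ) * Complex.I))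
    (fun y => ?_) ?_
  · exact ((measurable_delta k a b ω p q).comp (by fun_prop)).aestronglyMeasurable
  · filter_upwards [compl_mem_ae_iff.2 (measure_singleton (0 : ℝ))] with x hx
    obtain ⟨L, -, h1, h2⟩ := boundaryValue_delta s hs k a b ω p q x hx
    rw [h2]
    exact h1

theorem norm_osc (k : ℕ) (a b t x : ℝ) : ‖osc k a b t x‖ = 1 := by
  rw [osc, mul_comm, Complex.norm_exp_ofReal_mul_I]

theorem measurable_osc (k : ℕ) (a b t : ℝ) : Measurable (osc k a b t) := by
  unfold osc phase
  fun_prop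

theorem memLp_sq (s : ℝ) (hs : s = 1 ∨ s = -1) (k : ℕ) (a b ω t : ℝ) (p q c : ℂ) :
    MemLp (fun x => boundaryValue s (delta k a b ω p q) x ^ 2 * c * (osc k a b t x)⁻¹) ∞
      (volume : Measure ℝ) := by
  refine memLp_top_of_bound (((aestronglyMeasurable_boundaryValue s hs k a b ω p q).pow 2 |>.mul
    aestronglyMeasurable_const).mul (measurable_osc k a b t).inv.aestronglyMeasurable)
    (Real.exp (Real.pi * |nu p q|) ^ 2 * ‖c‖) ?_
  filter_upwards [compl_mem_ae_iff.2 (measure_singleton (0 : ℝ))] with x hx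
  obtain ⟨L, h0, -, h2⟩ := boundaryValue_delta s hs k a b ω p q x hx
  rw [h2, norm_mul, norm_mul, norm_inv, norm_osc, norm_pow, Complex.norm_exp, inv_one, mul_one]
  gcongr
  exact (abs_le.1 h0).2

theorem memLp_inv_sq (s : ℝ) (hs : s = 1 ∨ s = -1) (k : ℕ) (a b ω t : ℝ) (p q c : ℂ) :
    MemLp (fun x => (boundaryValue s (delta k a b ω p q) x ^ 2)⁻¹ * c * osc k a b t x) ∞
      (volume : Measure ℝ) := by
  refine memLp_top_of_bound ((((aestronglyMeasurable_boundaryValue s hs k a b ω p q).pow 2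
    |>.aemeasurable.inv.aestronglyMeasurable).mul aestronglyMeasurable_const).mul
    (measurable_osc k a b t).aestronglyMeasurable)
    (Real.exp (Real.pi * |nu p q|) ^ 2 * ‖c‖) ?_
  filter_upwards [compl_mem_ae_iff.2 (measure_singleton (0 : ℝ))] with x hx
  obtain ⟨L, h0, -, h2⟩ := boundaryValue_delta s hs k a b ω p q x hx
  rw [h2, norm_mul, norm_mul, norm_osc, norm_inv, norm_pow, Complex.norm_exp, mul_one, ← inv_pow,
    ← Real.exp_neg]
  gcongr
  linarith [(abs_le.1 h0).1]

theorem measurableSet_DPlus (k : ℕ) (a b : ℝ) : MeasurableSet (DPlus k a b) :=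
  measurableSet_lt measurable_const (measurable_deriv _)

theorem measurableSet_DMinus (k : ℕ) (a b : ℝ) : MeasurableSet (DMinus k a b) :=
  measurableSet_lt (measurable_deriv _) measurable_const

open Classical in
theorem memLp_ite {A B : Set ℝ} (hA : MeasurableSet A) (hB : MeasurableSet B) {f g : ℝ → ℂ}
    (hf : MemLp f ∞ (volume : Measure ℝ)) (hg : MemLp g ∞ (volume : Measure ℝ)) :
    MemLp (fun x => if x ∈ A then f x else if x ∈ B then g x else 0) ∞ (volume : Measure ℝ) := by
  refine MemLp.piecewise (s := A) (f := f) (g := fun x => if x ∈ B then g x else 0) hA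
    (hf.restrict A) (MemLp.restrict _ ?_)
  exact MemLp.piecewise (s := B) (f := g) (g := fun _ => 0) hB (hg.restrict B) MemLp.zero'

/-- The entries of `w⁻_M` belong to `L^∞(ℝ)`. -/
theorem memLp_weightMinusFun (k : ℕ) (a b ω t : ℝ) (p q : ℂ) (i j : Fin 2) :
    MemLp (fun x => weightMinusFun k a b ω t p q x i j) ∞ (volume : Measure ℝ) := by
  have hz : MemLp (fun _ : ℝ => (0 : ℂ)) ∞ (volume : Measure ℝ) := MemLp.zero'
  have h1 := memLp_ite (measurableSet_DPlus k a b) (measurableSet_DMinus k a b)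
    (memLp_sq (-1) (Or.inr rfl) k a b ω t p q p) hz
  have h2 := memLp_ite (measurableSet_DPlus k a b) (measurableSet_DMinus k a b) hz
    (memLp_inv_sq (-1) (Or.inr rfl) k a b ω t p q (q / (1 + p * q)))
  fin_cases i <;> fin_cases j
  · refine hz.congr_norm (hz.1.congr ?_) ?_ <;>
      exact Eventually.of_forall fun x => by simp only [weightMinusFun]; split_ifs <;> simp
  · convert h1 using 2 with x
    simp only [weightMinusFun]; split_ifs <;> simp [deltaMinus]
  · convert h2 using 2 with x
    simp only [weightMinusFun]; split_ifs <;> simp [deltaMinus]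
  · refine hz.congr_norm (hz.1.congr ?_) ?_ <;>
      exact Eventually.of_forall fun x => by simp only [weightMinusFun]; split_ifs <;> simp

/-- The entries of `w⁺_M` belong to `L^∞(ℝ)`. -/
theorem memLp_weightPlusFun (k : ℕ) (a b ω t : ℝ) (p q : ℂ) (i j : Fin 2) :
    MemLp (fun x => weightPlusFun k a b ω t p q x i j) ∞ (volume : Measure ℝ) := by
  have hz : MemLp (fun _ : ℝ => (0 : ℂ)) ∞ (volume : Measure ℝ) := MemLp.zero'
  have h1 := memLp_ite (measurableSet_DPlus k a b) (measurableSet_DMinus k a b) hz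
    (memLp_sq 1 (Or.inl rfl) k a b ω t p q (p / (1 + p * q)))
  have h2 := memLp_ite (measurableSet_DPlus k a b) (measurableSet_DMinus k a b)
    (memLp_inv_sq 1 (Or.inl rfl) k a b ω t p q q) hz
  fin_cases i <;> fin_cases j
  · refine hz.congr_norm (hz.1.congr ?_) ?_ <;>
      exact Eventually.of_forall fun x => by simp only [weightPlusFun]; split_ifs <;> simp
  · convert h1 using 2 with x
    simp only [weightPlusFun]; split_ifs <;> simp [deltaPlus]
  · convert h2 using 2 with x
    simp only [weightPlusFun]; split_ifs <;> simp [deltaPlus]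
  · refine hz.congr_norm (hz.1.congr ?_) ?_ <;>
      exact Eventually.of_forall fun x => by simp only [weightPlusFun]; split_ifs <;> simp

/-- The model weight `w⁻_M` as a matrix of `L^∞` functions. -/
def weightMinus (k : ℕ) (a b ω t : ℝ) (p q : ℂ) : Matrix (Fin 2) (Fin 2) LInf :=
  fun i j => (memLp_weightMinusFun k a b ω t p q i j).toLp

/-- The model weight `w⁺_M` as a matrix of `L^∞` functions. -/
def weightPlus (k : ℕ) (a b ω t : ℝ) (p q : ℂ) : Matrix (Fin 2) (Fin 2) LInf :=
  fun i j => (memLp_weightPlusFun k a b ω t p q i j).toLp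

/-- The Beals–Coifman operator `C_{w_M}` of the model weights. -/
def modelOperator (k : ℕ) (a b ω t : ℝ) (p q : ℂ) : L2Mat →L[ℂ] L2Mat :=
  bealsCoifman (weightMinus k a b ω t p q) (weightPlus k a b ω t p q)

end ModelRHP

end

namespace ModelRHP

/-! Only the moduli of the weights matter; the oscillation and the phase of `δ` play no role. On
`D₊` the boundary values of `δ` have modulus 1. On `D₋` the choice of `ν` gives `|δ_±|² = (1 +
pq)^(±1)`, which exactly cancels the denominators `1 + pq`. So almost everywhere each nonzero entry
of a weight has modulus `|p|` (upper right) or `|q|` (lower left), and for each of these two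
positions at most one of `w⁻`, `w⁺` is nonzero.

Since the Hardy spaces of the two half planes are orthogonal, `C₊ u + C₋ v` has squared norm at most
`‖u‖² + ‖v‖²`, so no constant is lost (`norm_cauchyPlus_add_cauchyMinus_sq_le`). The weights are
off-diagonal, so `T = C_w` exchanges the columns of `f`, with norm at most `|p|` in one direction
and `|q|` in the other. Although `T` itself need not be a contraction, `‖T²‖ ≤ |pq| < 1`
(`norm_modelOperator_mul_self_le`), and `(1 + T)(1 - T²)⁻¹` inverts `1 - T`
(`exists_inverse_one_sub`).

Orthogonality (`hardySpace_isOrtho`) comes from Cauchy's theorem: an inner product of boundary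
values is a limit of integrals over horizontal lines of an `H¹` function, and those integrals
vanish. -/

/-! ### Cauchy's theorem on horizontal lines and orthogonality of the Hardy spaces -/

theorem im_ofReal_add_ofReal_mul_I (x y : ℝ) : ((x : ℂ) + (y : ℂ) * Complex.I).im = y := by simp

/-- Fubini on the strip: each horizontal line contributes at most `K`, and the strip has finite
height. This controls the vertical sides of the rectangles in Cauchy's theorem. -/
theorem integrable_strip {h : ℂ → ℂ} (hd : ContinuousOn h {z : ℂ | 0 < z.im}) {K : ℝ}
    (hint : ∀ y : ℝ, 0 < y → Integrable (fun x : ℝ => h ((x : ℂ) + (y : ℂ) * Complex.I)))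
    (hK : ∀ y : ℝ, 0 < y → ∫ x : ℝ, ‖h ((x : ℂ) + (y : ℂ) * Complex.I)‖ ≤ K)
    {y Y : ℝ} (hy : 0 < y) :
    Integrable (fun x : ℝ => ∫ t in Set.Ioc y Y, ‖h ((x : ℂ) + (t : ℂ) * Complex.I)‖) := by
  have hm : AEStronglyMeasurable
      (fun z : ℝ × ℝ => h ((z.1 : ℂ) + (z.2 : ℂ) * Complex.I))
      ((volume : Measure ℝ).prod (volume.restrict (Set.Ioc y Y))) := by
    have h1 : (volume : Measure ℝ).prod (volume.restrict (Set.Ioc y Y)) =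
        ((volume : Measure ℝ).prod volume).restrict (Set.univ ×ˢ Set.Ioc y Y) := by
      rw [← Measure.prod_restrict, Measure.restrict_univ]
    rw [h1]
    refine ContinuousOn.aestronglyMeasurable ?_ (MeasurableSet.univ.prod measurableSet_Ioc)
    refine hd.comp (by fun_prop) fun z hz => ?_
    have : y < z.2 := hz.2.1
    simpa using hy.trans this
  refine Integrable.integral_norm_prod_left
    (f := fun z : ℝ × ℝ => h ((z.1 : ℂ) + (z.2 : ℂ) * Complex.I)) ?_
  have hpos : ∀ᵐ t ∂(volume.restrict (Set.Ioc y Y)), 0 < t := by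
    filter_upwards [ae_restrict_mem measurableSet_Ioc] with t ht
    exact hy.trans ht.1
  rw [integrable_prod_iff' hm]
  refine ⟨hpos.mono fun t ht => hint t ht, ?_⟩
  refine Integrable.mono' (integrable_const K) hm.norm.prod_swap.integral_prod_right' ?_
  filter_upwards [hpos] with t ht
  rw [Real.norm_of_nonneg (integral_nonneg fun _ => norm_nonneg _)]
  exact hK t ht

/-- Otherwise a superlevel set would contain a half line, which has infinite measure. -/
theorem frequently_lt_of_integrable {g : ℝ → ℝ} (hg : Integrable g) {ε : ℝ} (hε : 0 < ε) :
    ∃ᶠ R in atTop, g R < ε := by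
  intro hev
  obtain ⟨N, hN⟩ := eventually_atTop.1 hev
  have h1 := hg.measure_ge_lt_top hε
  have h2 : Set.Ici N ⊆ {a | ε ≤ g a} := fun x hx => not_lt.1 (hN x hx)
  have h3 := measure_mono (μ := volume) h2
  rw [Real.volume_Ici] at h3
  exact absurd h1 (not_lt.2 h3)

/-- The integrals of a holomorphic function over two horizontal lines agree. -/
theorem integral_line_eq {h : ℂ → ℂ} (hd : DifferentiableOn ℂ h {z : ℂ | 0 < z.im}) {K : ℝ}
    (hint : ∀ y : ℝ, 0 < y → Integrable (fun x : ℝ => h ((x : ℂ) + (y : ℂ) * Complex.I)))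
    (hK : ∀ y : ℝ, 0 < y → ∫ x : ℝ, ‖h ((x : ℂ) + (y : ℂ) * Complex.I)‖ ≤ K)
    {y Y : ℝ} (hy : 0 < y) (hyY : y ≤ Y) :
    ∫ x : ℝ, h ((x : ℂ) + (y : ℂ) * Complex.I) = ∫ x : ℝ, h ((x : ℂ) + (Y : ℂ) * Complex.I) := by
  set s : ℝ → ℝ := fun x => ∫ t in Set.Ioc y Y, ‖h ((x : ℂ) + (t : ℂ) * Complex.I)‖ with hs
  have hsi : Integrable s := integrable_strip hd.continuousOn hint hK hy
  -- No pointwise decay of `h` is available. Adding the bounds for both vertical sides lets one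
  -- arbitrarily large `R` make both small; frequently many such `R` suffice because the limit of
  -- the horizontal integrals exists.
  have hgi : Integrable (fun R => s R + s (-R)) := hsi.add hsi.comp_neg
  have hlim (v : ℝ) (hv : 0 < v) := intervalIntegral_tendsto_integral (hint v hv)
    tendsto_neg_atTop_atBot tendsto_id
  have hD := ((hlim y hy).sub (hlim Y (hy.trans_le hyY))).norm
  rw [← sub_eq_zero, ← norm_le_zero_iff]
  refine le_of_forall_pos_le_add fun ε hε => ?_
  rw [zero_add]
  refine le_of_tendsto_of_frequently hD ((frequently_lt_of_integrable hgi hε).mono fun R hR => ?_)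
  refine le_trans ?_ hR.le
  have hrect := Complex.integral_boundary_rect_eq_zero_of_differentiableOn h
    (((-R : ℝ) : ℂ) + (y : ℂ) * Complex.I) ((R : ℂ) + (Y : ℂ) * Complex.I) (hd.mono (by
      intro z hz
      have h2 := hz.2
      simp only [im_ofReal_add_ofReal_mul_I, Set.mem_preimage, Set.uIcc_of_le hyY] at h2
      exact hy.trans_le h2.1))
  have hre (u v : ℝ) : ((u : ℂ) + (v : ℂ) * Complex.I).re = u := by simp
  simp only [im_ofReal_add_ofReal_mul_I, hre] at hrect
  have hside (u : ℝ) : ‖Complex.I • ∫ t in y..Y, h ((u : ℂ) + (t : ℂ) * Complex.I)‖ ≤ s u := by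
    rw [norm_smul, Complex.norm_I, one_mul, intervalIntegral.integral_of_le hyY]
    exact norm_integral_le_integral_norm _
  have heq := eq_neg_of_add_eq_zero_left ((add_sub_assoc _ _ _).symm.trans hrect)
  simp only [id]
  rw [heq, norm_neg]
  exact (norm_sub_le _ _).trans (add_le_add (hside R) (hside (-R)))

/-- The integral of an `H¹` function over a horizontal line vanishes. -/
theorem integral_line_eq_zero {h : ℂ → ℂ} (hd : DifferentiableOn ℂ h {z : ℂ | 0 < z.im}) {K : ℝ}
    (hint : ∀ y : ℝ, 0 < y → Integrable (fun x : ℝ => h ((x : ℂ) + (y : ℂ) * Complex.I)))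
    (hK : ∀ y : ℝ, 0 < y → ∫ x : ℝ, ‖h ((x : ℂ) + (y : ℂ) * Complex.I)‖ ≤ K)
    {y : ℝ} (hy : 0 < y) : ∫ x : ℝ, h ((x : ℂ) + (y : ℂ) * Complex.I) = 0 := by
  have hnexp (e x v : ℝ) :
      ‖Complex.exp (Complex.I * e * ((x : ℂ) + (v : ℂ) * Complex.I))‖ = Real.exp (-(e * v)) := by
    rw [Complex.norm_exp]
    congr 1
    simp
  have hle1 {e v : ℝ} (he : 0 ≤ e) (hv : 0 ≤ v) : Real.exp (-(e * v)) ≤ 1 :=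
    Real.exp_le_one_iff.2 (neg_nonpos.2 (mul_nonneg he hv))
  have hcont (e v : ℝ) : Continuous fun x : ℝ =>
      Complex.exp (Complex.I * e * ((x : ℂ) + (v : ℂ) * Complex.I)) := by fun_prop
  -- Multiplication by `exp(iez)` keeps the integral independent of the height while bounding it by
  -- `exp(-ev) K` at height `v`, so raising the line to infinity forces it to be zero.
  have hdamped (e : ℝ) (he : 0 < e) :
      ∫ x : ℝ, Complex.exp (Complex.I * e * ((x : ℂ) + (y : ℂ) * Complex.I)) *
        h ((x : ℂ) + (y : ℂ) * Complex.I) = 0 := by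
    have hi (v : ℝ) (hv : 0 < v) : Integrable (fun x : ℝ =>
        Complex.exp (Complex.I * e * ((x : ℂ) + (v : ℂ) * Complex.I)) *
          h ((x : ℂ) + (v : ℂ) * Complex.I)) :=
      (hint v hv).bdd_mul (c := 1) (hcont e v).aestronglyMeasurable
        (Eventually.of_forall fun x => (hnexp e x v).trans_le (hle1 he.le hv.le))
    have hn (v : ℝ) (hv : 0 < v) :
        ∫ x : ℝ, ‖Complex.exp (Complex.I * e * ((x : ℂ) + (v : ℂ) * Complex.I)) *
          h ((x : ℂ) + (v : ℂ) * Complex.I)‖ ≤ Real.exp (-(e * v)) * K := by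
      simp only [norm_mul, hnexp]
      rw [integral_const_mul]
      exact mul_le_mul_of_nonneg_left (hK v hv) (Real.exp_pos _).le
    have hK0 : 0 ≤ K := (integral_nonneg fun _ => norm_nonneg _).trans (hK y hy)
    have hconst (Y : ℝ) (hY : y ≤ Y) := integral_line_eq
      (h := fun z => Complex.exp (Complex.I * e * z) * h z)
      ((Complex.differentiable_exp.comp
        (differentiable_id.const_mul (Complex.I * (e : ℂ)))).differentiableOn.mul hd)
      hi (fun v hv => (hn v hv).trans (mul_le_of_le_one_left hK0 (hle1 he.le hv.le))) hy hY
    rw [← norm_le_zero_iff]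
    have hlim : Tendsto (fun Y : ℝ => Real.exp (-(e * Y)) * K) atTop (𝓝 0) := by
      have := (Real.tendsto_exp_neg_atTop_nhds_zero.comp
        (tendsto_id.const_mul_atTop he)).mul_const K
      simpa using this
    refine ge_of_tendsto hlim ?_
    filter_upwards [eventually_ge_atTop y] with Y hY
    rw [hconst Y hY]
    exact (norm_integral_le_integral_norm _).trans (hn Y (hy.trans_le hY))
  -- The damping is removed by dominated convergence as `e → 0+`.
  have hlim : Tendsto (fun e : ℝ =>
      ∫ x : ℝ, Complex.exp (Complex.I * e * ((x : ℂ) + (y : ℂ) * Complex.I)) *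
        h ((x : ℂ) + (y : ℂ) * Complex.I)) (𝓝[>] 0)
      (𝓝 (∫ x : ℝ, h ((x : ℂ) + (y : ℂ) * Complex.I))) := by
    refine tendsto_integral_filter_of_dominated_convergence
      (fun x => ‖h ((x : ℂ) + (y : ℂ) * Complex.I)‖)
      (Eventually.of_forall fun e =>
        (hcont e y).aestronglyMeasurable.mul (hint y hy).aestronglyMeasurable) ?_
      (hint y hy).norm (Eventually.of_forall fun x => ?_)
    · filter_upwards [self_mem_nhdsWithin] with e he
      refine Eventually.of_forall fun x => ?_
      rw [norm_mul, hnexp]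
      exact mul_le_of_le_one_left (norm_nonneg _) (hle1 (le_of_lt he) hy.le)
    · have hc : Continuous fun e : ℝ =>
          Complex.exp (Complex.I * e * ((x : ℂ) + (y : ℂ) * Complex.I)) *
            h ((x : ℂ) + (y : ℂ) * Complex.I) := by fun_prop
      have := hc.tendsto 0
      simp only [Complex.ofReal_zero, mul_zero, zero_mul, Complex.exp_zero, one_mul] at this
      exact this.mono_left nhdsWithin_le_nhds
  refine tendsto_nhds_unique hlim (tendsto_const_nhds.congr' ?_)
  filter_upwards [self_mem_nhdsWithin] with e he
  exact (hdamped e he).symm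

/-- The Hardy spaces of the lower and upper half planes are orthogonal. -/
theorem hardySpace_isOrtho :
    (hardySpace (-1) (by norm_num)) ⟂ (hardySpace 1 (by norm_num)) := by
  rw [Submodule.isOrtho_iff_inner_eq]
  rintro f ⟨F, hF, ⟨M, hM, hFM⟩, hFf⟩ g ⟨G, hG, ⟨N, hN, hGN⟩, hGg⟩
  have hFc {y : ℝ} (hy : 0 < y) := continuous_line hF (by norm_num) hy
  have hGc {y : ℝ} (hy : 0 < y) := continuous_line hG (by norm_num) hy
  have hFm (y : ℝ) (hy : 0 < y) :
      MemLp (fun x : ℝ => F ((x : ℂ) + ((-1 * y : ℝ) : ℂ) * Complex.I)) 2 volume :=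
    ⟨(hFc hy).aestronglyMeasurable, (hFM y hy).trans_lt hM⟩
  have hGm (y : ℝ) (hy : 0 < y) :
      MemLp (fun x : ℝ => G ((x : ℂ) + ((1 * y : ℝ) : ℂ) * Complex.I)) 2 volume :=
    ⟨(hGc hy).aestronglyMeasurable, (hGN y hy).trans_lt hN⟩
  -- Reflection turns `F`, holomorphic below the axis, into a function holomorphic above it, so that
  -- `h` is holomorphic and on the line at height `y` equals the pointwise inner product of `F` at
  -- height `-y` and `G` at height `y`.
  set h : ℂ → ℂ := fun z => G z * (starRingEnd ℂ) (F ((starRingEnd ℂ) z)) with hh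
  have hline (x y : ℝ) : h ((x : ℂ) + (y : ℂ) * Complex.I) =
      inner ℂ (F ((x : ℂ) + ((-1 * y : ℝ) : ℂ) * Complex.I))
        (G ((x : ℂ) + ((1 * y : ℝ) : ℂ) * Complex.I)) := by
    simp [hh]
  have hd : DifferentiableOn ℂ h {z : ℂ | 0 < z.im} := by
    refine DifferentiableOn.mul (hG.mono fun z hz => by simpa using hz) fun z hz => ?_
    refine (DifferentiableAt.conj_conj (f := F) (x := (starRingEnd ℂ) z) ?_ |> fun h => by
      simpa [Function.comp_def] using h.differentiableWithinAt)
    refine hF.differentiableAt (IsOpen.mem_nhds (isOpen_lt (by fun_prop) (by fun_prop)) ?_)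
    simpa using hz
  have hint (y : ℝ) (hy : 0 < y) :
      Integrable (fun x : ℝ => h ((x : ℂ) + (y : ℂ) * Complex.I)) := by
    simp only [hline]
    exact ((hFm y hy).star.integrable_mul (hGm y hy)).congr
      (Eventually.of_forall fun x => by simp [mul_comm])
  have hinner (y : ℝ) (hy : 0 < y) :
      inner ℂ (hFm y hy).toLp (hGm y hy).toLp = ∫ x : ℝ, h ((x : ℂ) + (y : ℂ) * Complex.I) := by
    rw [L2.inner_def]
    refine integral_congr_ae ?_
    filter_upwards [(hFm y hy).coeFn_toLp, (hGm y hy).coeFn_toLp] with x h1 h2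
    rw [h1, h2, hline]
  have hK (y : ℝ) (hy : 0 < y) :
      ∫ x : ℝ, ‖h ((x : ℂ) + (y : ℂ) * Complex.I)‖ ≤ (M * N).toReal := by
    rw [integral_norm_eq_lintegral_enorm (hint y hy).aestronglyMeasurable,
      ← eLpNorm_one_eq_lintegral_enorm]
    refine ENNReal.toReal_mono (ENNReal.mul_lt_top hM hN).ne ?_
    simp only [hline]
    refine (eLpNorm_le_eLpNorm_mul_eLpNorm_of_nnnorm (p := 2) (q := 2)
      (hFc hy).aestronglyMeasurable (hGc hy).aestronglyMeasurable (fun a b => inner ℂ a b) 1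
      (Eventually.of_forall fun x => by simp [mul_comm])).trans ?_
    rw [ENNReal.coe_one, one_mul]
    exact mul_le_mul' (hFM y hy) (hGN y hy)
  have hzero (y : ℝ) (hy : 0 < y) : inner ℂ (hFm y hy).toLp (hGm y hy).toLp = (0 : ℂ) :=
    (hinner y hy).trans (integral_line_eq_zero hd hint hK hy)
  -- The lines give elements of `L²` only for `y > 0`, so convergence is stated along the filter
  -- pulled back to the positive reals.
  have hlim {s : ℝ} {H : ℂ → ℂ} {u : L2}
      (hm : ∀ y : ℝ, 0 < y →
        MemLp (fun x : ℝ => H ((x : ℂ) + ((s * y : ℝ) : ℂ) * Complex.I)) 2 volume)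
      (ht : Tendsto (fun y : ℝ =>
        eLpNorm (fun x : ℝ => H ((x : ℂ) + ((s * y : ℝ) : ℂ) * Complex.I) - u x) 2 volume)
        (𝓝[>] 0) (𝓝 0)) :
      Tendsto (fun y : Set.Ioi (0 : ℝ) => (hm y y.2).toLp) (comap Subtype.val (𝓝[>] 0)) (𝓝 u) := by
    rw [Lp.tendsto_Lp_iff_tendsto_eLpNorm']
    refine (ht.comp tendsto_comap).congr fun y => eLpNorm_congr_ae ?_
    filter_upwards [(hm y y.2).coeFn_toLp] with x hx
    rw [Pi.sub_apply, hx]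
  have : (comap (Subtype.val : Set.Ioi (0 : ℝ) → ℝ) (𝓝[>] 0)).NeBot :=
    NeBot.comap_of_range_mem inferInstance (by
      rw [Subtype.range_coe]; exact self_mem_nhdsWithin)
  exact tendsto_nhds_unique ((hlim hFm hFf).inner (hlim hGm hGg))
    (tendsto_const_nhds.congr fun y => (hzero y y.2).symm)

theorem norm_hardyProj_apply_le (s : ℝ) (hs : s * s = 1) (u : L2) : ‖hardyProj s hs u‖ ≤ ‖u‖ :=
  ContinuousLinearMap.le_of_opNorm_le _ (Submodule.starProjection_norm_le _) u |>.trans_eq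
    (one_mul _)

/-- `C₊ u + C₋ v` is an orthogonal sum. -/
theorem norm_cauchyPlus_add_cauchyMinus_sq_le (u v : L2) :
    ‖cauchyPlus u + cauchyMinus v‖ ^ 2 ≤ ‖u‖ ^ 2 + ‖v‖ ^ 2 := by
  have hortho : inner ℂ (hardyProj (-1) (by norm_num) v) (hardyProj 1 (by norm_num) u) = (0 : ℂ) := by
    refine (Submodule.isOrtho_iff_inner_eq.1 ?_) _ (Submodule.starProjection_apply_mem _ _) _
      (Submodule.starProjection_apply_mem _ _)
    -- The projections are onto closures; orthogonality passes to them because orthogonal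
    -- complements are closed.
    rw [Submodule.IsOrtho, Submodule.orthogonal_closure]
    exact Submodule.topologicalClosure_minimal _ hardySpace_isOrtho
      (Submodule.isClosed_orthogonal _)
  have h1 : cauchyPlus u + cauchyMinus v =
      hardyProj 1 (by norm_num) u - hardyProj (-1) (by norm_num) v := by
    simp [cauchyPlus, cauchyMinus, sub_eq_add_neg]
  rw [h1, norm_sub_rev, @norm_sub_sq ℂ, hortho]
  have h2 := norm_hardyProj_apply_le 1 (by norm_num) u
  have h3 := norm_hardyProj_apply_le (-1) (by norm_num) v
  have h4 := pow_le_pow_left₀ (norm_nonneg _) h2 2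
  have h5 := pow_le_pow_left₀ (norm_nonneg _) h3 2
  simp only [map_zero, mul_zero, sub_zero]
  linarith

/-! ### The sets `D_±` and the modulus of `δ_±` -/

theorem deriv_phase (k : ℕ) (a b x : ℝ) : deriv (phase k a b) x = b * ((k + 1) * x ^ k) := by
  have h : HasDerivAt (phase k a b) (b * ((k + 1) * x ^ k)) x := by
    have h := ((hasDerivAt_pow (k + 1) x).const_mul b).const_add a
    push_cast at h
    exact h
  exact h.deriv

theorem mem_DPlus (k : ℕ) (a b x : ℝ) : x ∈ DPlus k a b ↔ 0 < b * x ^ k := by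
  have h : (0 : ℝ) < k + 1 := by positivity
  rw [DPlus, Set.mem_ofPred_eq, deriv_phase, mul_left_comm]
  exact mul_pos_iff_of_pos_left h

theorem mem_DMinus (k : ℕ) (a b x : ℝ) : x ∈ DMinus k a b ↔ b * x ^ k < 0 := by
  have h : (0 : ℝ) < k + 1 := by positivity
  rw [DMinus, Set.mem_ofPred_eq, deriv_phase, mul_left_comm]
  refine ⟨fun h1 => ?_, mul_neg_of_pos_of_neg h⟩
  by_contra h2
  exact absurd h1 (not_lt.2 (mul_nonneg h.le (not_lt.1 h2)))

theorem notMem_DMinus_of_mem_DPlus {k : ℕ} {a b x : ℝ} (h : x ∈ DPlus k a b) : x ∉ DMinus k a b := by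
  rw [mem_DMinus]
  exact not_lt.2 ((mem_DPlus k a b x).1 h).le

/-- The three geometric cases for the position of `0` relative to the closure of `D₋`. -/
theorem DMinus_cases {k : ℕ} (hk : 1 ≤ k) (a : ℝ) {b : ℝ} (hb : b ≠ 0) :
    (Even k ∧ DMinus k a b = ∅) ∨ (Even k ∧ DMinus k a b = {0}ᶜ) ∨
    (eps k b = 1 ∧ DMinus k a b = Set.Iio 0) ∨ (eps k b = -1 ∧ DMinus k a b = Set.Ioi 0) := by
  have hk0 : k ≠ 0 := by omega
  rcases Nat.even_or_odd k with he | ho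
  · rcases lt_or_gt_of_ne hb with h | h
    · refine Or.inr (Or.inl ⟨he, Set.ext fun x => ?_⟩)
      rw [mem_DMinus, mul_neg_iff, or_iff_right (fun h1 => h.not_gt h1.1), and_iff_right h, he.pow_pos_iff hk0]
      simp
    · refine Or.inl ⟨he, Set.eq_empty_of_forall_notMem fun x hx => ?_⟩
      rw [mem_DMinus] at hx
      exact absurd hx (not_lt.2 (mul_nonneg h.le (he.pow_nonneg x)))
  · have hne : ¬ Even k := Nat.not_even_iff_odd.2 ho
    rcases lt_or_gt_of_ne hb with h | h
    · refine Or.inr (Or.inr (Or.inr ⟨by simp [eps, hne, Real.sign_of_neg h], Set.ext fun x => ?_⟩))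
      rw [mem_DMinus, mul_neg_iff, or_iff_right (fun h1 => h.not_gt h1.1), and_iff_right h, ho.pow_pos_iff, Set.mem_Ioi]
    · refine Or.inr (Or.inr (Or.inl ⟨by simp [eps, hne, Real.sign_of_pos h], Set.ext fun x => ?_⟩))
      rw [mem_DMinus, mul_neg_iff, or_iff_left (fun h1 => h.not_gt h1.1), and_iff_right h, ho.pow_neg_iff, Set.mem_Iio]

theorem beta_of_empty {k : ℕ} {a b : ℝ} (h : DMinus k a b = ∅) (p q z : ℂ) :
    beta k a b p q z = 0 := by
  simp [beta, h]

theorem beta_of_compl_singleton {k : ℕ} {a b : ℝ} (h : DMinus k a b = {0}ᶜ) (p q z : ℂ) :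
    beta k a b p q z = -((Real.pi * nu p q * Real.sign z.im : ℝ) : ℂ) := by
  have : closure ({0}ᶜ : Set ℝ) = Set.univ := (dense_compl_singleton (0 : ℝ)).closure_eq
  simp [beta, h, this]

theorem beta_of_half_line {k : ℕ} {a b : ℝ}
    (h : DMinus k a b = Set.Iio 0 ∨ DMinus k a b = Set.Ioi 0) (p q z : ℂ) :
    beta k a b p q z =
      Complex.I * (eps k b : ℂ) * (nu p q : ℂ) * Complex.log ((eps k b : ℂ) * z) := by
  rcases h with h | h <;> simp [beta, h]

theorem re_log_term (e v : ℝ) (z : ℂ) :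
    (Complex.I * (e : ℂ) * (v : ℂ) * Complex.log ((e : ℂ) * z)).re = -(e * v * ((e : ℂ) * z).arg) := by
  simp [Complex.log_im, mul_assoc]

theorem tendsto_line (s c x : ℝ) :
    Tendsto (fun y : ℝ => (c : ℂ) * ((x : ℂ) + ((s * y : ℝ) : ℂ) * Complex.I))
      (𝓝[>] (0 : ℝ)) (𝓝 ((c * x : ℝ) : ℂ)) := by
  have hc : Continuous (fun y : ℝ => (c : ℂ) * ((x : ℂ) + ((s * y : ℝ) : ℂ) * Complex.I)) := by
    fun_prop
  have := hc.tendsto 0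
  simp only [mul_zero, Complex.ofReal_zero, zero_mul, add_zero, ← Complex.ofReal_mul] at this
  exact this.mono_left nhdsWithin_le_nhds

theorem tendsto_arg_of_pos (s : ℝ) {c x : ℝ} (h : 0 < c * x) :
    Tendsto (fun y : ℝ => ((c : ℂ) * ((x : ℂ) + ((s * y : ℝ) : ℂ) * Complex.I)).arg)
      (𝓝[>] (0 : ℝ)) (𝓝 0) := by
  have h1 := (Complex.continuousAt_arg (x := ((c * x : ℝ) : ℂ))
    (Complex.mem_slitPlane_iff.2 (Or.inl (by simpa using h)))).tendsto.comp (tendsto_line s c x)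
  rwa [Complex.arg_ofReal_of_nonneg h.le] at h1

/-- The limit lies on the cut of the logarithm, and the sign of `c * s` tells from which side it is
approached. This is the source of the jump of `|δ|` across `D₋`. -/
theorem tendsto_arg_of_neg {s c x : ℝ} (h : c * x < 0) (hcs : c * s = 1 ∨ c * s = -1) :
    Tendsto (fun y : ℝ => ((c : ℂ) * ((x : ℂ) + ((s * y : ℝ) : ℂ) * Complex.I)).arg)
      (𝓝[>] (0 : ℝ)) (𝓝 (c * s * Real.pi)) := by
  have him (y : ℝ) : ((c : ℂ) * ((x : ℂ) + ((s * y : ℝ) : ℂ) * Complex.I)).im = c * s * y := by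
    simp [mul_assoc]
  rcases hcs with hcs | hcs
  · rw [hcs, one_mul]
    refine (Complex.tendsto_arg_nhdsWithin_im_nonneg_of_re_neg_of_im_zero
        (z := ((c * x : ℝ) : ℂ)) (by simpa using h) (by simp)).comp
        (tendsto_nhdsWithin_iff.2 ⟨tendsto_line s c x, ?_⟩)
    filter_upwards [self_mem_nhdsWithin] with y hy
    have hy : 0 < y := hy
    change 0 ≤ Complex.im _
    rw [him, hcs]
    linarith
  · rw [hcs, neg_one_mul]
    refine (Complex.tendsto_arg_nhdsWithin_im_neg_of_re_neg_of_im_zero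
        (z := ((c * x : ℝ) : ℂ)) (by simpa using h) (by simp)).comp
        (tendsto_nhdsWithin_iff.2 ⟨tendsto_line s c x, ?_⟩)
    filter_upwards [self_mem_nhdsWithin] with y hy
    have hy : 0 < y := hy
    change Complex.im _ < 0
    rw [him, hcs]
    linarith

/-- In the logarithmic case `ε x > 0` on `D₊`, away from the cut, so the argument tends to 0. -/
theorem tendsto_re_beta_DPlus {k : ℕ} (hk : 1 ≤ k) {a b : ℝ} (hb : b ≠ 0) (p q : ℂ) (s : ℝ) {x : ℝ}
    (hx : x ∈ DPlus k a b) :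
    Tendsto (fun y : ℝ => (beta k a b p q ((x : ℂ) + ((s * y : ℝ) : ℂ) * Complex.I)).re)
      (𝓝[>] (0 : ℝ)) (𝓝 0) := by
  have hx' := notMem_DMinus_of_mem_DPlus hx
  have hx0 : x ≠ 0 := by
    rintro rfl
    rw [mem_DPlus, zero_pow (by omega)] at hx
    simp at hx
  have key (h : DMinus k a b = Set.Iio 0 ∨ DMinus k a b = Set.Ioi 0) (hpos : 0 < eps k b * x) :
      Tendsto (fun y : ℝ => (beta k a b p q ((x : ℂ) + ((s * y : ℝ) : ℂ) * Complex.I)).re)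
      (𝓝[>] (0 : ℝ)) (𝓝 0) := by
    simp only [beta_of_half_line h, re_log_term]
    simpa using ((tendsto_arg_of_pos s hpos).const_mul (eps k b * nu p q)).neg
  rcases DMinus_cases hk a hb with ⟨-, h⟩ | ⟨-, h⟩ | ⟨he, h⟩ | ⟨he, h⟩
  · simp [beta_of_empty h]
  · rw [h] at hx'
    exact absurd (by simpa using hx') hx0
  · refine key (Or.inl h) ?_
    rw [h, Set.mem_Iio, not_lt] at hx'
    rw [he, one_mul]
    exact lt_of_le_of_ne hx' hx0.symm
  · refine key (Or.inr h) ?_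
    rw [h, Set.mem_Ioi, not_lt] at hx'
    rw [he, neg_one_mul, neg_pos]
    exact lt_of_le_of_ne hx' hx0

/-- In the logarithmic case `ε x < 0` on `D₋`, the argument tends to `ε s π`, and `ε² = 1` removes
the dependence on `ε`. The value then agrees with that of the step function used when `0` is
interior. -/
theorem tendsto_re_beta_DMinus {k : ℕ} (hk : 1 ≤ k) {a b : ℝ} (hb : b ≠ 0) (p q : ℂ) {s : ℝ}
    (hs : s = 1 ∨ s = -1) {x : ℝ} (hx : x ∈ DMinus k a b) :
    Tendsto (fun y : ℝ => (beta k a b p q ((x : ℂ) + ((s * y : ℝ) : ℂ) * Complex.I)).re)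
      (𝓝[>] (0 : ℝ)) (𝓝 (-(s * (Real.pi * nu p q)))) := by
  have key (h : DMinus k a b = Set.Iio 0 ∨ DMinus k a b = Set.Ioi 0) (hneg : eps k b * x < 0)
      (he : eps k b = 1 ∨ eps k b = -1) :
      Tendsto (fun y : ℝ => (beta k a b p q ((x : ℂ) + ((s * y : ℝ) : ℂ) * Complex.I)).re)
      (𝓝[>] (0 : ℝ)) (𝓝 (-(s * (Real.pi * nu p q)))) := by
    simp only [beta_of_half_line h, re_log_term]
    have hcs : eps k b * s = 1 ∨ eps k b * s = -1 := by
      rcases he with he | he <;> rcases hs with hs | hs <;> simp [he, hs]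
    convert ((tendsto_arg_of_neg hneg hcs).const_mul (eps k b * nu p q)).neg using 3
    rcases he with he | he <;> rw [he] <;> ring
  rcases DMinus_cases hk a hb with ⟨-, h⟩ | ⟨-, h⟩ | ⟨he, h⟩ | ⟨he, h⟩
  · simp [h] at hx
  · simp only [beta_of_compl_singleton h]
    refine tendsto_const_nhds.congr' ?_
    filter_upwards [self_mem_nhdsWithin] with y hy
    have hy : 0 < y := hy
    have h1 : ((x : ℂ) + ((s * y : ℝ) : ℂ) * Complex.I).im = s * y := by
      simp only [Complex.add_im, Complex.ofReal_im, Complex.im_ofReal_mul, Complex.I_im, mul_one,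
        zero_add]
    rw [h1, Complex.neg_re, Complex.ofReal_re]
    rcases hs with rfl | rfl
    · rw [Real.sign_of_pos (by linarith), mul_one, one_mul]
    · rw [Real.sign_of_neg (by linarith)]
      ring
  · rw [h, Set.mem_Iio] at hx
    exact key (Or.inl h) (by rwa [he, one_mul]) (Or.inl he)
  · rw [h, Set.mem_Ioi] at hx
    exact key (Or.inr h) (by rw [he]; linarith) (Or.inr he)

theorem norm_boundaryValue_delta {s : ℝ} (hs : s = 1 ∨ s = -1) {k : ℕ} {a b : ℝ} (ω : ℝ) {p q : ℂ}
    {x r : ℝ} (hx : x ≠ 0)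
    (h : Tendsto (fun y : ℝ => (beta k a b p q ((x : ℂ) + ((s * y : ℝ) : ℂ) * Complex.I)).re)
      (𝓝[>] (0 : ℝ)) (𝓝 r)) :
    ‖boundaryValue s (delta k a b ω p q) x‖ = Real.exp r := by
  obtain ⟨L, -, h1, h2⟩ := boundaryValue_delta s hs k a b ω p q x hx
  rw [h2]
  refine tendsto_nhds_unique h1.norm (((Real.continuous_exp.tendsto r).comp h).congr fun y => ?_)
  simp [delta, Complex.norm_exp]

theorem norm_boundaryValue_DPlus {s : ℝ} (hs : s = 1 ∨ s = -1) {k : ℕ} (hk : 1 ≤ k) {a b : ℝ}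
    (hb : b ≠ 0) (ω : ℝ) (p q : ℂ) {x : ℝ} (hx : x ∈ DPlus k a b) :
    ‖boundaryValue s (delta k a b ω p q) x‖ = 1 := by
  have hx0 : x ≠ 0 := by
    rintro rfl
    rw [mem_DPlus, zero_pow (by omega)] at hx
    simp at hx
  rw [norm_boundaryValue_delta hs ω hx0 (tendsto_re_beta_DPlus hk hb p q s hx), Real.exp_zero]

/-- The normalisation of `ν` is made for this: `2 · (-sπν) = s log(1 + pq)`. -/
theorem norm_boundaryValue_DMinus_sq {s : ℝ} (hs : s = 1 ∨ s = -1) {k : ℕ} (hk : 1 ≤ k) {a b : ℝ}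
    (hb : b ≠ 0) (ω : ℝ) {p q : ℂ} {x : ℝ} (hx : x ∈ DMinus k a b) :
    ‖boundaryValue s (delta k a b ω p q) x‖ ^ 2 = Real.exp (s * Real.log (1 + (p * q).re)) := by
  have hx0 : x ≠ 0 := by
    rintro rfl
    rw [mem_DMinus, zero_pow (by omega)] at hx
    simp at hx
  rw [norm_boundaryValue_delta hs ω hx0 (tendsto_re_beta_DMinus hk hb p q hs hx), ← Real.exp_nat_mul]
  congr 1
  rw [nu]
  have := Real.pi_ne_zero
  push_cast
  field_simp

/-! ### Moduli of the model weights -/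

theorem norm_one_add {p q : ℂ} (hreal : (p * q).im = 0) (hlow : -1 < (p * q).re) :
    ‖1 + p * q‖ = 1 + (p * q).re := by
  have h : 1 + p * q = ((1 + (p * q).re : ℝ) : ℂ) := Complex.ext (by simp) (by simpa using hreal)
  conv_lhs => rw [h]
  rw [Complex.norm_real, Real.norm_of_nonneg (by linarith)]

/-- In each row of the operator, the two weights acting on the first column of `f` have disjoint
supports and are bounded by `|p|`. -/
theorem norm_weight_zero_one_sq_le {p q : ℂ} (hreal : (p * q).im = 0) (hlow : -1 < (p * q).re)
    {k : ℕ} (hk : 1 ≤ k) (a : ℝ) {b : ℝ} (hb : b ≠ 0) (ω t x : ℝ) :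
    ‖weightMinusFun k a b ω t p q x 0 1‖ ^ 2 + ‖weightPlusFun k a b ω t p q x 0 1‖ ^ 2 ≤
      ‖p‖ ^ 2 := by
  have hpos : 0 < 1 + (p * q).re := by linarith
  by_cases h1 : x ∈ DPlus k a b
  · simp [weightMinusFun, weightPlusFun, h1, norm_osc, deltaMinus,
      norm_boundaryValue_DPlus (Or.inr rfl) hk hb ω p q h1]
  by_cases h2 : x ∈ DMinus k a b
  · have h3 := norm_boundaryValue_DMinus_sq (s := 1) (Or.inl rfl) hk hb ω (p := p) (q := q) h2
    rw [one_mul, Real.exp_log hpos] at h3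
    have h4 : ‖weightPlusFun k a b ω t p q x 0 1‖ = ‖p‖ := by
      simp only [weightPlusFun, h1, h2, if_true, if_false, deltaPlus, Matrix.of_apply,
        Matrix.cons_val', Matrix.cons_val_zero, Matrix.cons_val_one, Matrix.cons_val_fin_one]
      rw [norm_mul, norm_mul, norm_pow, h3, norm_inv, norm_osc, norm_div,
        norm_one_add hreal hlow]
      field_simp
    rw [h4]
    simp [weightMinusFun, h1, h2]
  · simp [weightMinusFun, weightPlusFun, h1, h2]

/-- In each row of the operator, the two weights acting on the second column of `f` have disjoint
supports and are bounded by `|q|`. -/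
theorem norm_weight_one_zero_sq_le {p q : ℂ} (hreal : (p * q).im = 0) (hlow : -1 < (p * q).re)
    {k : ℕ} (hk : 1 ≤ k) (a : ℝ) {b : ℝ} (hb : b ≠ 0) (ω t x : ℝ) :
    ‖weightMinusFun k a b ω t p q x 1 0‖ ^ 2 + ‖weightPlusFun k a b ω t p q x 1 0‖ ^ 2 ≤
      ‖q‖ ^ 2 := by
  have hpos : 0 < 1 + (p * q).re := by linarith
  by_cases h1 : x ∈ DPlus k a b
  · simp [weightMinusFun, weightPlusFun, h1, norm_osc, deltaPlus,
      norm_boundaryValue_DPlus (Or.inl rfl) hk hb ω p q h1]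
  by_cases h2 : x ∈ DMinus k a b
  · have h3 := norm_boundaryValue_DMinus_sq (s := -1) (Or.inr rfl) hk hb ω (p := p) (q := q) h2
    rw [neg_one_mul, Real.exp_neg, Real.exp_log hpos] at h3
    have h4 : ‖weightMinusFun k a b ω t p q x 1 0‖ = ‖q‖ := by
      simp only [weightMinusFun, h1, h2, if_true, if_false, deltaMinus, Matrix.of_apply,
        Matrix.cons_val', Matrix.cons_val_zero, Matrix.cons_val_one, Matrix.cons_val_fin_one]
      rw [norm_mul, norm_mul, norm_inv, norm_pow, h3, norm_osc, norm_div,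
        norm_one_add hreal hlow]
      field_simp
    rw [h4]
    simp [weightPlusFun, h1, h2]
  · simp [weightMinusFun, weightPlusFun, h1, h2]

/-! ### Multiplication operators and inversion through the square -/

theorem coeFn_mulOp (g : LInf) (u : L2) : mulOp g u =ᵐ[volume] fun x => g x * u x :=
  ContinuousLinearMap.coeFn_holder (r := 2) (ContinuousLinearMap.mul ℂ ℂ) g u

theorem mulOp_zero (u : L2) : mulOp 0 u = 0 := by
  simp [mulOp]

theorem norm_sq_eq_integral (u : L2) : ‖u‖ ^ 2 = ∫ x, ‖u x‖ ^ 2 := by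
  have h := congrArg Complex.re (L2.inner_def (𝕜 := ℂ) u u)
  rw [inner_self_eq_norm_sq_to_K] at h
  have h2 : ∀ x, inner ℂ (u x) (u x) = ((‖u x‖ ^ 2 : ℝ) : ℂ) := fun x => by
    rw [inner_self_eq_norm_sq_to_K]; simp
  simp only [h2] at h
  rw [integral_complex_ofReal] at h
  simpa [← Complex.ofReal_pow] using h

theorem integrable_norm_sq (u : L2) : Integrable fun x => ‖u x‖ ^ 2 :=
  (memLp_two_iff_integrable_sq_norm (Lp.aestronglyMeasurable u)).1 (Lp.memLp u)

/-- Bounding the sum of squares pointwise, rather than each multiplier separately, uses the disjoint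
supports of the weights and avoids a factor 2. -/
theorem norm_mulOp_sq_add_le {g h : LInf} {c : ℝ}
    (hc : ∀ᵐ x : ℝ, ‖g x‖ ^ 2 + ‖h x‖ ^ 2 ≤ c ^ 2) (u : L2) :
    ‖mulOp g u‖ ^ 2 + ‖mulOp h u‖ ^ 2 ≤ c ^ 2 * ‖u‖ ^ 2 := by
  rw [norm_sq_eq_integral, norm_sq_eq_integral (mulOp h u), norm_sq_eq_integral u,
    ← integral_add (integrable_norm_sq _) (integrable_norm_sq _), ← integral_const_mul]
  refine integral_mono_ae ((integrable_norm_sq _).add (integrable_norm_sq _))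
    ((integrable_norm_sq u).const_mul _) ?_
  filter_upwards [hc, coeFn_mulOp g u, coeFn_mulOp h u] with x h1 h2 h3
  simp only [h2, h3, norm_mul, mul_pow]
  rw [← add_mul]
  exact mul_le_mul_of_nonneg_right h1 (by positivity)

theorem L2Mat_norm_le {c : ℝ} (hc : 0 ≤ c) {f g : L2Mat} (h : ∀ ij, ‖f ij‖ ≤ c * ‖g ij‖) :
    ‖f‖ ≤ c * ‖g‖ := by
  refine (sq_le_sq₀ (norm_nonneg _) (by positivity)).1 ?_
  rw [mul_pow, PiLp.norm_sq_eq_of_L2, PiLp.norm_sq_eq_of_L2, Finset.mul_sum]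
  refine Finset.sum_le_sum fun ij _ => ?_
  rw [← mul_pow]
  exact pow_le_pow_left₀ (norm_nonneg _) (h ij) 2

/-- If `T²` is a strict contraction then `1 - T` is invertible, with inverse `(1 + T)(1 - T²)⁻¹`. -/
theorem exists_inverse_one_sub {E : Type*} [NormedAddCommGroup E] [NormedSpace ℂ E]
    [CompleteSpace E] (T : E →L[ℂ] E) {m r : ℝ} (hT : ‖T‖ ≤ m) (hr : r < 1)
    (hTr : ‖T * T‖ ≤ r) :
    ∃ R : E →L[ℂ] E, (1 - T) * R = 1 ∧ R * (1 - T) = 1 ∧ ‖R‖ ≤ (1 + m) * (1 - r)⁻¹ := by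
  have hlt : ‖T * T‖ < 1 := hTr.trans_lt hr
  have h1 := mul_neg_geom_series (T * T) hlt
  have h2 := geom_series_mul_neg (T * T) hlt
  set S := ∑' n : ℕ, (T * T) ^ n with hS
  -- An inequality, since `E` may be trivial; it absorbs the term `‖1‖ - 1` in the geometric series
  -- bound.
  have hone : ‖(1 : E →L[ℂ] E)‖ ≤ 1 := ContinuousLinearMap.norm_id_le
  have hSn : ‖S‖ ≤ (1 - r)⁻¹ := by
    have h3 := tsum_geometric_le_of_norm_lt_one (T * T) hlt
    have h4 : (1 - ‖T * T‖)⁻¹ ≤ (1 - r)⁻¹ := inv_anti₀ (by linarith) (by linarith)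
    linarith
  have hright : (1 - T) * ((1 + T) * S) = 1 := by
    rw [← mul_assoc]
    refine Eq.trans (congrArg (· * S) ?_) h1
    noncomm_ring
  have hleft : (S * (1 + T)) * (1 - T) = 1 := by
    rw [mul_assoc]
    refine Eq.trans (congrArg (S * ·) ?_) h2
    noncomm_ring
  refine ⟨(1 + T) * S, hright, ?_, ?_⟩
  · rwa [← left_inv_eq_right_inv hleft hright]
  · have hm : ‖1 + T‖ ≤ 1 + m := (norm_add_le _ _).trans (add_le_add hone hT)
    exact (norm_mul_le _ _).trans
      (mul_le_mul hm hSn (norm_nonneg _) ((norm_nonneg _).trans hm))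

/-! ### Norm estimates for the model operator -/

theorem toLp_eq_zero {g : ℝ → ℂ} (hg : MemLp g ∞ (volume : Measure ℝ)) (h : ∀ x, g x = 0) :
    hg.toLp = 0 :=
  (MemLp.toLp_eq_toLp_iff hg MemLp.zero).2 (Eventually.of_forall h)

theorem weightMinus_diag (k : ℕ) (a b ω t : ℝ) (p q : ℂ) (i : Fin 2) :
    weightMinus k a b ω t p q i i = 0 := by
  refine toLp_eq_zero _ fun x => ?_
  fin_cases i <;> (simp only [weightMinusFun]; split_ifs <;> simp)

theorem weightPlus_diag (k : ℕ) (a b ω t : ℝ) (p q : ℂ) (i : Fin 2) :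
    weightPlus k a b ω t p q i i = 0 := by
  refine toLp_eq_zero _ fun x => ?_
  fin_cases i <;> (simp only [weightPlusFun]; split_ifs <;> simp)

/-- Orthogonality of the two Cauchy terms matches the sum of squares in the pointwise bound, so the
constant `c` survives unchanged. -/
theorem norm_cauchy_mulOp_le {g h : LInf} {c : ℝ} (hc0 : 0 ≤ c)
    (hc : ∀ᵐ x : ℝ, ‖g x‖ ^ 2 + ‖h x‖ ^ 2 ≤ c ^ 2) (u : L2) :
    ‖cauchyPlus (mulOp g u) + cauchyMinus (mulOp h u)‖ ≤ c * ‖u‖ := by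
  refine (sq_le_sq₀ (norm_nonneg _) (by positivity)).1 ?_
  rw [mul_pow]
  exact (norm_cauchyPlus_add_cauchyMinus_sq_le _ _).trans (norm_mulOp_sq_add_le hc u)

theorem norm_modelOperator_apply_one_le {p q : ℂ} (hreal : (p * q).im = 0) (hlow : -1 < (p * q).re) {k : ℕ} (hk : 1 ≤ k)
    (a : ℝ) {b : ℝ} (hb : b ≠ 0) (ω t : ℝ) (f : L2Mat) (i : Fin 2) :
    ‖modelOperator k a b ω t p q f (i, 1)‖ ≤ ‖p‖ * ‖f (i, 0)‖ := by
  rw [modelOperator, bealsCoifman_apply]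
  simp only [Fin.sum_univ_two, weightMinus_diag, weightPlus_diag, mulOp_zero, add_zero]
  refine norm_cauchy_mulOp_le (norm_nonneg _) ?_ _
  filter_upwards [(memLp_weightMinusFun k a b ω t p q 0 1).coeFn_toLp,
    (memLp_weightPlusFun k a b ω t p q 0 1).coeFn_toLp] with x h1 h2
  rw [weightMinus, weightPlus, h1, h2]
  exact norm_weight_zero_one_sq_le hreal hlow hk a hb ω t x

theorem norm_modelOperator_apply_zero_le {p q : ℂ} (hreal : (p * q).im = 0) (hlow : -1 < (p * q).re) {k : ℕ} (hk : 1 ≤ k)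
    (a : ℝ) {b : ℝ} (hb : b ≠ 0) (ω t : ℝ) (f : L2Mat) (i : Fin 2) :
    ‖modelOperator k a b ω t p q f (i, 0)‖ ≤ ‖q‖ * ‖f (i, 1)‖ := by
  rw [modelOperator, bealsCoifman_apply]
  simp only [Fin.sum_univ_two, weightMinus_diag, weightPlus_diag, mulOp_zero, zero_add]
  refine norm_cauchy_mulOp_le (norm_nonneg _) ?_ _
  filter_upwards [(memLp_weightMinusFun k a b ω t p q 1 0).coeFn_toLp,
    (memLp_weightPlusFun k a b ω t p q 1 0).coeFn_toLp] with x h1 h2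
  rw [weightMinus, weightPlus, h1, h2]
  exact norm_weight_one_zero_sq_le hreal hlow hk a hb ω t x

/-- This bound may exceed 1; it serves only to estimate the factor `1 + T` of the inverse. -/
theorem norm_modelOperator_le {p q : ℂ} (hreal : (p * q).im = 0) (hlow : -1 < (p * q).re) {k : ℕ} (hk : 1 ≤ k)
    (a : ℝ) {b : ℝ} (hb : b ≠ 0) (ω t : ℝ) :
    ‖modelOperator k a b ω t p q‖ ≤ max ‖p‖ ‖q‖ := by
  have h0 : 0 ≤ max ‖p‖ ‖q‖ := (norm_nonneg p).trans (le_max_left _ _)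
  refine ContinuousLinearMap.opNorm_le_bound _ h0 fun f => ?_
  -- `g` is `f` with its columns exchanged (addition in `Fin 2`), so that the column estimates
  -- become entrywise bounds by `g`.
  let g : L2Mat := WithLp.toLp 2 fun ij => f (ij.1, ij.2 + 1)
  have hg : ‖g‖ = ‖f‖ := by
    refine (sq_eq_sq₀ (norm_nonneg _) (norm_nonneg _)).1 ?_
    simp only [PiLp.norm_sq_eq_of_L2, Fintype.sum_prod_type, Fin.sum_univ_two, g]
    simp [add_comm]
  rw [← hg]
  refine L2Mat_norm_le h0 ?_
  rintro ⟨i, j⟩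
  fin_cases j
  · exact (norm_modelOperator_apply_zero_le hreal hlow hk a hb ω t f i).trans
      (mul_le_mul_of_nonneg_right (le_max_right _ _) (norm_nonneg _))
  · exact (norm_modelOperator_apply_one_le hreal hlow hk a hb ω t f i).trans
      (mul_le_mul_of_nonneg_right (le_max_left _ _) (norm_nonneg _))

/-- Two applications bring each column back to its place and cost one factor `|p|` and one factor
`|q|`, so only the product has to be small. -/
theorem norm_modelOperator_mul_self_le {p q : ℂ} (hreal : (p * q).im = 0) (hlow : -1 < (p * q).re) {k : ℕ} (hk : 1 ≤ k)
    (a : ℝ) {b : ℝ} (hb : b ≠ 0) (ω t : ℝ) :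
    ‖modelOperator k a b ω t p q * modelOperator k a b ω t p q‖ ≤ ‖p * q‖ := by
  refine ContinuousLinearMap.opNorm_le_bound _ (norm_nonneg _) fun f => ?_
  refine L2Mat_norm_le (norm_nonneg _) ?_
  have h1 := norm_modelOperator_apply_one_le hreal hlow hk a hb ω t
  have h0 := norm_modelOperator_apply_zero_le hreal hlow hk a hb ω t
  rintro ⟨i, j⟩
  rw [norm_mul]
  fin_cases j
  · refine (h0 (modelOperator k a b ω t p q f) i).trans ?_
    rw [mul_comm ‖p‖, mul_assoc]
    exact mul_le_mul_of_nonneg_left (h1 f i) (norm_nonneg _)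
  · refine (h1 (modelOperator k a b ω t p q f) i).trans ?_
    rw [mul_assoc]
    exact mul_le_mul_of_nonneg_left (h0 f i) (norm_nonneg _)

end ModelRHP

theorem mainTheorem10 (p q : ℂ) (hreal : (p * q).im = 0) (hlow : -1 < (p * q).re)
    (hupp : (p * q).re < 1) :
    ∃ C : ℝ, ∀ (k : ℕ) (a b ω t : ℝ), 1 ≤ k → b ≠ 0 →
      ∃ R : ModelRHP.L2Mat →L[ℂ] ModelRHP.L2Mat,
        (1 - ModelRHP.modelOperator k a b ω t p q) * R = 1 ∧
        R * (1 - ModelRHP.modelOperator k a b ω t p q) = 1 ∧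
        ‖R‖ ≤ C := by
  -- As `pq` is real, its modulus is the absolute value of its real part.
  have hlt : ‖p * q‖ < 1 := by
    rw [show p * q = (((p * q).re : ℝ) : ℂ) from Complex.ext rfl hreal, Complex.norm_real,
      Real.norm_eq_abs]
    exact abs_lt.2 ⟨hlow, hupp⟩
  exact ⟨(1 + max ‖p‖ ‖q‖) * (1 - ‖p * q‖)⁻¹, fun k a b ω t hk hb =>
    ModelRHP.exists_inverse_one_sub _
      (ModelRHP.norm_modelOperator_le hreal hlow hk a hb ω t) hlt
      (ModelRHP.norm_modelOperator_mul_self_le hreal hlow hk a hb ω t)⟩
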